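/- For a finite matroid $M$ with ground set $E$ and rank function $r$, let $$T_M(x,y)=\sum_{A\subseteq E}(x-1)^{r(E)-r(A)}(y-1)^{|A|-r(A)}\in\mathbb{Z}[x,y]$$ be its Tutte polynomial. For a graph $G$, let $M(G)$ be its graphic (cycle) matroid: the ground set is the edge set of $G$, and a set of edges is independent if and only if it contains no cycle of $G$. **Theorem.** For every integer $n\ge 3$, the graphic matroid $M(K_n)$ of the complete graph on $n$ vertices satisfies $$\max\{T_{M(K_n)}(2,0),\,T_{M(K_n)}(0,2)\}\ \ge\ T_{M(K_n)}(1,1).$$ -/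

import Mathlib

namespace SimpleGraph

/-- A set of non-diagonal edges is the edge set of the graph that it spans. -/
theorem edgeSet_fromEdgeSet_of_subset {V : Type*} {G : SimpleGraph V} {I : Set (Sym2 V)}
    (hI : I ⊆ G.edgeSet) : (fromEdgeSet I).edgeSet = I := by
  rw [edgeSet_fromEdgeSet, sdiff_eq_left, Set.disjoint_left]
  exact fun e he hd => G.not_isDiag_of_mem_edgeSet (hI he) hd

/-- Maximal acyclic edge sets inside `X` correspond to maximal acyclic subgraphs of the graph
spanned by `X`. -/
theorem maximal_acyclic_edges_iff {V : Type*} {G : SimpleGraph V} {X I : Set (Sym2 V)}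
    (hX : X ⊆ G.edgeSet) (hIX : I ⊆ X) :
    Maximal (fun K : Set (Sym2 V) =>
        (K ⊆ G.edgeSet ∧ (fromEdgeSet K).IsAcyclic) ∧ K ⊆ X) I ↔
      Maximal (fun H => H ≤ fromEdgeSet X ∧ H.IsAcyclic) (fromEdgeSet I) := by
  constructor
  · rintro ⟨⟨⟨hI, hac⟩, -⟩, hmax⟩
    refine ⟨⟨fromEdgeSet_mono hIX, hac⟩, fun H hH hle => ?_⟩
    have hHX : H.edgeSet ⊆ X := by
      rw [← edgeSet_fromEdgeSet_of_subset hX]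
      exact edgeSet_mono hH.1
    have hIH : I ≤ H.edgeSet := by
      rw [← edgeSet_fromEdgeSet_of_subset hI]
      exact edgeSet_mono hle
    have h := hmax ⟨⟨hHX.trans hX, by simpa using hH.2⟩, hHX⟩ hIH
    simpa using fromEdgeSet_mono h
  · rintro ⟨⟨_, hac⟩, hmax⟩
    refine ⟨⟨⟨hIX.trans hX, hac⟩, hIX⟩, fun K hK hle => ?_⟩
    have h := edgeSet_mono (hmax ⟨fromEdgeSet_mono hK.2, hK.1.2⟩ (fromEdgeSet_mono hle))
    rwa [edgeSet_fromEdgeSet_of_subset hK.1.1,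
      edgeSet_fromEdgeSet_of_subset (hIX.trans hX)] at h

/-- The cycle matroid (graphic matroid) `M(G)` of a simple graph `G`: its elements are the edges
of `G`, and a set of edges is independent iff it contains no cycle. -/
def cycleMatroid {V : Type*} (G : SimpleGraph V) : Matroid (Sym2 V) :=
  IndepMatroid.matroid
    { E := G.edgeSet
      Indep := fun I => I ⊆ G.edgeSet ∧ (fromEdgeSet I).IsAcyclic
      indep_empty := by simp
      indep_subset := fun I J hJ hIJ => ⟨hIJ.trans hJ.1, hJ.2.anti (fromEdgeSet_mono hIJ)⟩
      indep_aug := by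
        intro I B hI hImax hB
        have key : ∀ K : Set (Sym2 V), K ⊆ G.edgeSet → (fromEdgeSet K).IsAcyclic →
            (Maximal (fun I => I ⊆ G.edgeSet ∧ (fromEdgeSet I).IsAcyclic) K ↔
              (fromEdgeSet K).Reachable = G.Reachable) := by
          intro K hK hac
          have h1 := maximal_acyclic_edges_iff (G := G) subset_rfl hK
          rw [fromEdgeSet_edgeSet] at h1
          rw [← maximal_isAcyclic_iff_reachable_eq (G := G) ?_ hac, ← h1]
          · exact iff_of_eq (congrArg (fun P => Maximal P K) (by ext; tauto))
          · simpa using fromEdgeSet_mono hK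
        rw [key I hI.1 hI.2] at hImax
        have hBE := hB.prop.1
        rw [key B hB.prop.1 hB.prop.2] at hB
        by_contra! hcon
        have hadj : ∀ u v, (fromEdgeSet B).Adj u v → (fromEdgeSet I).Reachable u v := by
          intro u v huv
          by_contra hnr
          have heI : s(u, v) ∉ I := fun h =>
            hnr (Adj.reachable ((fromEdgeSet_adj I).2 ⟨h, huv.ne⟩))
          have hac := hI.2.sup_edge_of_not_reachable hnr
          rw [edge, ← fromEdgeSet_union, Set.union_singleton] at hac
          exact hcon _ ⟨huv.1, heI⟩ (Set.insert_subset (hBE huv.1) hI.1) hac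
        refine hImax ?_
        ext u v
        refine ⟨fun h => h.mono (by simpa using fromEdgeSet_mono hI.1), fun h => ?_⟩
        rw [← hB] at h
        obtain ⟨p⟩ := h
        induction p with
        | nil => exact .rfl
        | cons h p ih => exact (hadj _ _ h).trans ih
      indep_maximal := by
        intro X hX I hI hIX
        obtain ⟨H, hIH, hH⟩ :=
          exists_maximal_isAcyclic_of_le_isAcyclic (fromEdgeSet_mono hIX) hI.2
        have hHX : H.edgeSet ⊆ X := by
          rw [← edgeSet_fromEdgeSet_of_subset hX]
          exact edgeSet_mono hH.prop.1
        refine ⟨H.edgeSet, ?_, (maximal_acyclic_edges_iff hX hHX).2 (by simpa using hH)⟩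
        rw [← edgeSet_fromEdgeSet_of_subset hI.1]
        exact edgeSet_mono hIH
      subset_ground := fun I hI => hI.1 }

@[simp] theorem cycleMatroid_ground {V : Type*} (G : SimpleGraph V) :
    G.cycleMatroid.E = G.edgeSet := rfl

theorem cycleMatroid_indep_iff {V : Type*} (G : SimpleGraph V) (I : Set (Sym2 V)) :
    G.cycleMatroid.Indep I ↔ I ⊆ G.edgeSet ∧ (fromEdgeSet I).IsAcyclic := Iff.rfl

end SimpleGraph

namespace Matroid

/-- The Tutte polynomial of a matroid `M` on a finite ground set `E`, as an element of `ℤ[x, y]`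
with `x = X 0` and `y = X 1`:
`T_M(x, y) = ∑_{A ⊆ E} (x - 1) ^ (r(E) - r(A)) * (y - 1) ^ (|A| - r(A))`.
All ranks are finite here and `r(A) ≤ r(E)`, `r(A) ≤ |A|`, so nothing is truncated. -/
noncomputable def tuttePolynomial {α : Type*} (M : Matroid α) [M.Finite] :
    MvPolynomial (Fin 2) ℤ :=
  ∑ A ∈ M.ground_finite.toFinset.powerset,
    (MvPolynomial.X 0 - 1) ^ ((M.eRk M.E).toNat - (M.eRk (A : Set α)).toNat) *
      (MvPolynomial.X 1 - 1) ^ (A.card - (M.eRk (A : Set α)).toNat)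

end Matroid

/-! For n ≥ 4 the value T(0,2) alone suffices. With c(A) the number of components of (V, A), r(E) -
r(A) = c(A) - 1, so T(0,2) = -s_n, where s_n sums (-1)^c over all graphs on n vertices
(`signedComponentSum`). Exponential generating functions exp(C) for all graphs and exp(-C) for s_n
are inverse, which gives the recurrence `sum_signedComponentSum_eq_zero`. Its k = 0 term is 2^N with
N = n.choose 2; bounding |s_k| trivially in the others leaves -s_n ≥ (3/8) 2^N for n ≥ 6.

On the other side T(1,1) counts bases, which have n - 1 elements, so T(1,1) ≤ N.choose (n - 1) ≤ 2^N
/ 3. The cases n = 4, 5 use exact values of s_n. For n = 3, T(0,2) is too small and T(2,0) = 6 takes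
over. -/

namespace SimpleGraph

/-! ### Rank in the cycle matroid and connected components. -/

/-- In a finite forest, the edges and the connected components together are as many as the
vertices. -/
theorem IsAcyclic.ncard_edgeSet_add_card_connectedComponent {V : Type*} [Finite V]
    {G : SimpleGraph V} (hG : G.IsAcyclic) :
    G.edgeSet.ncard + Nat.card G.ConnectedComponent = Nat.card V := by
  classical
  have := Fintype.ofFinite V
  let _ : DecidableEq G.ConnectedComponent := Classical.decEq _
  -- Handshake in each component: a tree on k vertices has degree sum 2(k - 1).
  have hcomp : ∀ c : G.ConnectedComponent,
      (∑ v with G.connectedComponentMk v = c, G.degree v) + 2 =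
        ∑ v with G.connectedComponentMk v = c, 2 := by
    intro c
    have h1 := (hG.isTree_connectedComponent c).card_edgeFinset
    have h2 := c.toSimpleGraph.sum_degrees_eq_twice_card_edges
    have h3 : ∑ v with G.connectedComponentMk v = c, G.degree v =
        ∑ v : c, c.toSimpleGraph.degree v := by
      rw [Finset.sum_subtype (p := fun v => v ∈ c) _ (fun v => by simp; rfl)]
      refine Finset.sum_congr rfl fun v _ => ?_
      have := degree_induce_of_neighborSet_subset (G := G) (s := c.supp) (v := v) fun w hw =>
        c.mem_supp_of_adj_mem_supp v.2 hw
      rw [← this]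
      congr!
    have h4 : Fintype.card c = Finset.card {v | G.connectedComponentMk v = c} :=
      Fintype.card_of_subtype _ fun v => by simp; rfl
    rw [h3, h2, Finset.sum_const, ← h4, ← h1, smul_eq_mul]
    ring
  have hsum := Finset.sum_congr (rfl : (Finset.univ : Finset G.ConnectedComponent) = _)
    fun c _ => hcomp c
  rw [Finset.sum_add_distrib, Finset.sum_fiberwise, Finset.sum_fiberwise,
    G.sum_degrees_eq_twice_card_edges] at hsum
  rw [Set.ncard_eq_toFinset_card', Nat.card_eq_fintype_card, Nat.card_eq_fintype_card]
  change G.edgeFinset.card + _ = _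
  simp at hsum
  omega

theorem eRk_cycleMatroid {V : Type*} [Finite V] {G : SimpleGraph V} {X : Set (Sym2 V)}
    (hX : X ⊆ G.edgeSet) :
    (G.cycleMatroid.eRk X).toNat + Nat.card (fromEdgeSet X).ConnectedComponent = Nat.card V := by
  obtain ⟨I, hI⟩ := G.cycleMatroid.exists_isBasis X hX
  have hac := hI.indep.2
  have hmax := (maximal_acyclic_edges_iff hX hI.subset).1 hI.1
  have hreach := (maximal_isAcyclic_iff_reachable_eq (fromEdgeSet_mono hI.subset) hac).1 hmax
  -- A basis of X has the same reachability relation as X, hence literally the same quotient type.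
  have hcc : (fromEdgeSet I).ConnectedComponent = (fromEdgeSet X).ConnectedComponent := by
    unfold ConnectedComponent
    rw [hreach]
  rw [← hcc, ← hac.ncard_edgeSet_add_card_connectedComponent,
    edgeSet_fromEdgeSet_of_subset hI.indep.1, hI.eRk_eq_encard]
  rfl

/-! ### The recurrence for the signed component count. -/

open Finset

/-- The signed count of the graphs on `V` by number of connected components. -/
noncomputable def signedComponentSum (V : Type*) [Fintype V] : ℤ := by
  classical exact ∑ G : SimpleGraph V, (-1) ^ Nat.card G.ConnectedComponent

theorem card_eq_two_pow_choose (V : Type*) [Fintype V] :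
    Nat.card (SimpleGraph V) = 2 ^ (Fintype.card V).choose 2 := by
  classical
  have e : SimpleGraph V ≃ ((⊤ : SimpleGraph V).edgeFinset.powerset : Finset _) :=
    { toFun := fun G => ⟨G.edgeFinset, mem_powerset.2 (edgeFinset_mono le_top)⟩
      invFun := fun A => fromEdgeSet (A.1 : Set (Sym2 V))
      left_inv := fun G => by simp
      right_inv := fun A => by
        have := mem_powerset.1 A.2
        ext e
        simp
        have := @this e
        simp at this
        tauto }
  rw [Nat.card_congr e, Nat.card_eq_fintype_card, Fintype.card_coe, card_powerset,
    card_edgeFinset_top_eq_card_choose_two]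

theorem signedComponentSum_congr {V W : Type*} [Fintype V] [Fintype W] (e : V ≃ W) :
    signedComponentSum V = signedComponentSum W := by
  classical
  unfold signedComponentSum
  refine Fintype.sum_equiv e.simpleGraph _ _ fun G => ?_
  congr 1
  exact Nat.card_congr (Iso.connectedComponentEquiv (Iso.symm (Iso.comap e.symm G)))

/-- A vertex set closed under adjacency. -/
def IsAdjClosed {V : Type*} (G : SimpleGraph V) (S : Set V) : Prop :=
  ∀ ⦃a b⦄, G.Adj a b → (a ∈ S ↔ b ∈ S)

theorem IsAdjClosed.mem_iff {V : Type*} {G : SimpleGraph V} {S : Set V} (h : G.IsAdjClosed S)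
    {a b : V} (hab : G.Reachable a b) : a ∈ S ↔ b ∈ S := by
  obtain ⟨p⟩ := hab
  induction p with
  | nil => rfl
  | cons hadj _ ih => exact (h hadj).trans ih

theorem IsAdjClosed.reachable_induce {V : Type*} {G : SimpleGraph V} {S : Set V}
    (h : G.IsAdjClosed S) {a b : S} (hab : G.Reachable a b) : (G.induce S).Reachable a b := by
  obtain ⟨p⟩ := hab
  classical
  refine ⟨p.induce S fun x hx => ?_⟩
  exact (h.mem_iff (p.takeUntil x hx).reachable).1 a.2

/-- The components of the graph induced on a union of components. -/
theorem card_connectedComponent_induce_preimage {V : Type*} [Finite V] (G : SimpleGraph V)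
    (P : Set G.ConnectedComponent) :
    Nat.card (G.induce (G.connectedComponentMk ⁻¹' P)).ConnectedComponent = P.ncard := by
  have hcl : G.IsAdjClosed (G.connectedComponentMk ⁻¹' P) := fun a b hab => by
    simp [ConnectedComponent.connectedComponentMk_eq_of_adj hab]
  let f := ConnectedComponent.map (Embedding.induce (G := G) (G.connectedComponentMk ⁻¹' P)).toHom
  have hf : Function.Injective f := by
    refine ConnectedComponent.ind₂ fun a b hab => ConnectedComponent.sound ?_
    exact hcl.reachable_induce (ConnectedComponent.exact hab)
  have hr : Set.range f = P := by
    ext c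
    constructor
    · rintro ⟨d, rfl⟩
      induction d using ConnectedComponent.ind with
      | h v => exact v.2
    · induction c using ConnectedComponent.ind with
      | h v => exact fun hv => ⟨connectedComponentMk _ ⟨v, hv⟩, rfl⟩
  rw [Nat.card_congr (Equiv.ofInjective f hf), hr, Nat.card_coe_set_eq]

-- Closed sets S are exactly the unions of components, so this is the alternating sum over all
-- subsets of the nonempty set of components.
open Classical in
theorem sum_isAdjClosed_eq_zero {V : Type*} [Fintype V] [Nonempty V] (G : SimpleGraph V) :
    ∑ S ∈ univ.filter (fun S : Finset V => G.IsAdjClosed (S : Set V)),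
      (-1 : ℤ) ^ Nat.card (G.induce (S : Set V)).ConnectedComponent = 0 := by
  rw [← sum_powerset_neg_one_pow_card_of_nonempty (x := (univ : Finset G.ConnectedComponent))
    univ_nonempty]
  symm
  refine sum_nbij' (fun P => ({v | G.connectedComponentMk v ∈ P} : Finset V))
    (fun S : Finset V => S.image G.connectedComponentMk) ?_ ?_ ?_ ?_ ?_
  · intro P _
    simp only [mem_filter, mem_univ, true_and]
    intro a b hab
    simp [ConnectedComponent.connectedComponentMk_eq_of_adj hab]
  · simp
  · intro P _
    ext c
    induction c using ConnectedComponent.ind with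
    | h v =>
      simp only [mem_image, mem_filter, mem_univ, true_and]
      exact ⟨fun ⟨a, ha, h⟩ => h ▸ ha, fun h => ⟨v, h, rfl⟩⟩
  · intro S hS
    simp only [mem_filter, mem_univ, true_and] at hS
    ext v
    simp only [mem_image, mem_filter, mem_univ, true_and]
    exact ⟨fun ⟨a, ha, h⟩ => (hS.mem_iff (ConnectedComponent.exact h)).1 ha, fun h => ⟨v, h, rfl⟩⟩
  · intro P _
    have := card_connectedComponent_induce_preimage G (P : Set G.ConnectedComponent)
    rw [Set.ncard_coe_finset] at this
    rw [← this]
    have h : (({v | G.connectedComponentMk v ∈ P} : Finset V) : Set V) =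
      G.connectedComponentMk ⁻¹' (P : Set G.ConnectedComponent) := by ext; simp
    rw [h]

/-- The disjoint union of a graph on `S` and a graph on the complement of `S`. -/
def glueCompl {V : Type*} [Fintype V] [DecidableEq V] {S : Finset V} (H : SimpleGraph S)
    (K : SimpleGraph (Sᶜ : Finset V)) : SimpleGraph V where
  Adj a b := (∃ ha hb, H.Adj ⟨a, ha⟩ ⟨b, hb⟩) ∨ ∃ ha hb, K.Adj ⟨a, ha⟩ ⟨b, hb⟩
  symm := ⟨by
    rintro a b (⟨ha, hb, h⟩ | ⟨ha, hb, h⟩)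
    · exact .inl ⟨hb, ha, h.symm⟩
    · exact .inr ⟨hb, ha, h.symm⟩⟩
  loopless := ⟨by
    rintro a (⟨ha, hb, h⟩ | ⟨ha, hb, h⟩)
    · exact H.loopless.irrefl _ h
    · exact K.loopless.irrefl _ h⟩

-- A graph with no edge between S and its complement is a free choice of a graph on each side, and
-- only the side S carries a sign.
open Classical in
theorem sum_isAdjClosed_graphs {V : Type*} [Fintype V] [DecidableEq V] (S : Finset V) :
    ∑ G : SimpleGraph V with G.IsAdjClosed (S : Set V),
      (-1 : ℤ) ^ Nat.card (G.induce (S : Set V)).ConnectedComponent =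
        signedComponentSum S * Nat.card (SimpleGraph (Sᶜ : Finset V)) := by
  rw [signedComponentSum, Nat.card_eq_fintype_card, ← nsmul_one (Fintype.card _), ← card_univ,
    ← sum_const, sum_mul_sum, ← sum_product']
  refine sum_nbij' (fun G => (G.induce (S : Set V), G.comap (fun v : (Sᶜ : Finset V) => v.1)))
    (fun p => glueCompl p.1 p.2)
    ?_ ?_ ?_ ?_ ?_
  · simp
  · rintro ⟨H, K⟩ _
    simp only [mem_filter, mem_univ, true_and]
    rintro a b (⟨ha, hb, -⟩ | ⟨ha, hb, -⟩)
    · simp [ha, hb]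
    · rw [mem_compl] at ha hb
      simp [ha, hb]
  · intro G hG
    simp only [mem_filter, mem_univ, true_and] at hG
    ext a b
    have := @hG a b
    by_cases ha : a ∈ S <;> by_cases hb : b ∈ S <;> simp [ha, hb, glueCompl] at this ⊢ <;>
      assumption
  · rintro ⟨H, K⟩ _
    refine Prod.ext ?_ ?_
    · ext a b
      have ha : a.1 ∈ S := a.2
      have hb : b.1 ∈ S := b.2
      simp [glueCompl]
    · ext a b
      have ha := a.2
      have hb := b.2
      rw [mem_compl] at ha hb
      simp [ha, hb, glueCompl]
  · intro G _
    simp only [mul_one]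

/-- Double count pairs (G, S) with S a union of components of G, weighted by the sign of G on S:
summing over S first gives 0, summing over G first gives the product terms. -/
theorem sum_signedComponentSum_eq_zero {n : ℕ} (hn : n ≠ 0) :
    ∑ k ∈ range (n + 1), (n.choose k : ℤ) *
      (signedComponentSum (Fin k) * 2 ^ (n - k).choose 2) = 0 := by
  classical
  have : Nonempty (Fin n) := ⟨⟨0, Nat.pos_of_ne_zero hn⟩⟩
  have key : ∑ S : Finset (Fin n), signedComponentSum S * Nat.card (SimpleGraph (Sᶜ : Finset _))
      = 0 := by
    simp_rw [← sum_isAdjClosed_graphs]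
    rw [sum_comm' (t' := univ) (s' := fun G => {S | G.IsAdjClosed (S : Set (Fin n))})]
    · exact sum_eq_zero fun G _ => sum_isAdjClosed_eq_zero G
    · simp
  have h2 : ∀ S : Finset (Fin n),
      signedComponentSum S * Nat.card (SimpleGraph (Sᶜ : Finset _)) =
        (fun k => signedComponentSum (Fin k) * 2 ^ (n - k).choose 2) #S := by
    intro S
    rw [card_eq_two_pow_choose, Fintype.card_coe, card_compl, Fintype.card_fin,
      signedComponentSum_congr S.equivFin]
    simp
  have h3 := sum_powerset_apply_card
    (fun k => signedComponentSum (Fin k) * 2 ^ (n - k).choose 2) (x := (univ : Finset (Fin n)))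
  rw [powerset_univ, ← sum_congr rfl fun S _ => h2 S, key] at h3
  simpa using h3.symm

/-! ### Numerical estimates. -/

theorem abs_signedComponentSum_le (V : Type*) [Fintype V] :
    |signedComponentSum V| ≤ 2 ^ (Fintype.card V).choose 2 := by
  rw [signedComponentSum]
  refine (abs_sum_le_sum_abs _ _).trans ?_
  simp only [abs_pow, abs_neg, abs_one, one_pow, sum_const, nsmul_eq_mul, mul_one, card_univ]
  rw [@Fintype.card_eq_nat_card, card_eq_two_pow_choose, Nat.cast_pow, Nat.cast_ofNat]

theorem signedComponentSum_eq_sum {n : ℕ} (hn : n ≠ 0) :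
    -signedComponentSum (Fin n) =
      ∑ k ∈ range n, (n.choose k : ℤ) * (signedComponentSum (Fin k) * 2 ^ (n - k).choose 2) := by
  have h := sum_signedComponentSum_eq_zero hn
  rw [sum_range_succ] at h
  simp at h
  linarith

theorem signedComponentSum_of_isEmpty (V : Type*) [Fintype V] [IsEmpty V] :
    signedComponentSum V = 1 := by
  have h : ∀ G : SimpleGraph V, Nat.card G.ConnectedComponent = 0 := fun G => by
    have : IsEmpty G.ConnectedComponent := ⟨fun c => c.ind isEmptyElim⟩
    simp
  have h1 := card_eq_two_pow_choose V
  simp only [signedComponentSum, h, pow_zero, sum_const, card_univ,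
    Fintype.card_eq_nat_card (α := SimpleGraph V), h1]
  simp

theorem signedComponentSum_fin_one : signedComponentSum (Fin 1) = -1 := by
  have h := signedComponentSum_eq_sum one_ne_zero
  simp [signedComponentSum_of_isEmpty] at h
  linarith

theorem signedComponentSum_fin_two : signedComponentSum (Fin 2) = 0 := by
  have h := signedComponentSum_eq_sum two_ne_zero
  simp [sum_range_succ, signedComponentSum_of_isEmpty, signedComponentSum_fin_one] at h
  linarith

theorem signedComponentSum_fin_three : signedComponentSum (Fin 3) = -2 := by
  have h := signedComponentSum_eq_sum three_ne_zero
  simp [sum_range_succ, signedComponentSum_of_isEmpty, signedComponentSum_fin_one,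
    signedComponentSum_fin_two, Nat.choose] at h
  linarith

theorem signedComponentSum_fin_four : signedComponentSum (Fin 4) = -24 := by
  have h := signedComponentSum_eq_sum four_ne_zero
  simp [sum_range_succ, signedComponentSum_of_isEmpty, signedComponentSum_fin_one,
    signedComponentSum_fin_two, signedComponentSum_fin_three, Nat.choose] at h
  linarith

theorem signedComponentSum_fin_five : signedComponentSum (Fin 5) = -544 := by
  have h := signedComponentSum_eq_sum (n := 5) (by norm_num)
  simp [sum_range_succ, signedComponentSum_of_isEmpty, signedComponentSum_fin_one,
    signedComponentSum_fin_two, signedComponentSum_fin_three, signedComponentSum_fin_four,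
    Nat.choose] at h
  linarith

theorem two_pow_sub_le_neg_signedComponentSum {n : ℕ} (hn : n ≠ 0) :
    (2 : ℤ) ^ n.choose 2 - ∑ k ∈ Ico 1 n, (n.choose k : ℤ) * 2 ^ (k.choose 2 + (n - k).choose 2) ≤
      -signedComponentSum (Fin n) := by
  rw [signedComponentSum_eq_sum hn, range_eq_Ico, sum_eq_sum_Ico_succ_bot (Nat.pos_of_ne_zero hn),
    signedComponentSum_of_isEmpty, sub_eq_add_neg, ← sum_neg_distrib]
  refine add_le_add (by simp) (sum_le_sum fun k _ => ?_)
  have := (abs_le.1 (abs_signedComponentSum_le (Fin k))).1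
  rw [Fintype.card_fin] at this
  rw [← mul_neg, pow_add, ← neg_mul]
  gcongr

theorem choose_two_add (a b : ℕ) :
    (a + b).choose 2 = a.choose 2 + b.choose 2 + a * b := by
  induction a with
  | zero => simp
  | succ a ih =>
    rw [Nat.succ_add, Nat.choose_succ_succ' (a + b) 1, ih, Nat.choose_succ_succ' a 1]
    simp
    ring

/-- With n = m + 6, the exponent drops from n.choose 2 by k(n - k), which is at least 2(n - 2)
unless k is 1 or n - 1. There it is only n - 1, and the correction factor 2^(n-3) = 4^(n-2) /
2^(n-1) makes up the loss. -/
theorem choose_mul_two_pow_le {m k : ℕ} (hk : k ∈ Ico 1 (m + 6)) :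
    (m + 6).choose k * 2 ^ (k.choose 2 + (m + 6 - k).choose 2) * 4 ^ (m + 4) ≤
      2 ^ (m + 6).choose 2 * ((m + 6).choose k +
        ((if k = 1 then (m + 6) * 2 ^ (m + 3) else 0) +
          if k = m + 5 then (m + 6) * 2 ^ (m + 3) else 0)) := by
  rw [mem_Ico] at hk
  obtain ⟨j, hj⟩ := Nat.exists_eq_add_of_le hk.2.le
  have hjk : m + 6 - k = j := by omega
  have h4 : (4 : ℕ) ^ (m + 4) = 2 ^ (m + 5) * 2 ^ (m + 3) := by
    rw [show (4 : ℕ) = 2 ^ 2 by norm_num, ← pow_mul, ← pow_add]; congr 1; ring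
  rw [hjk]
  have hN : (m + 6).choose 2 = k.choose 2 + j.choose 2 + k * j := by rw [hj, choose_two_add]
  rw [hN, pow_add 2 (_ + _)]
  by_cases h1 : k = 1
  · have hj' : j = m + 5 := by omega
    subst h1 hj'
    rw [h4]
    simp
    rw [show ∀ a b c d : ℕ, a * b * (c * d) = b * c * (a * d) by intros; ring]
    gcongr
    omega
  by_cases h2 : k = m + 5
  · have hj' : j = 1 := by omega
    subst h2 hj'
    rw [h4]
    simp
    rw [show ∀ a b c d : ℕ, a * b * (c * d) = b * c * (a * d) by intros; ring]
    gcongr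
    exact Nat.le_add_left _ _
  · rw [if_neg h1, if_neg h2, add_zero, add_zero]
    have : 2 * (m + 4) ≤ k * j := by
      obtain ⟨a, rfl⟩ : ∃ a, k = a + 2 := ⟨k - 2, by omega⟩
      obtain ⟨b, rfl⟩ : ∃ b, j = b + 2 := ⟨j - 2, by omega⟩
      have : m + 2 = a + b := by omega
      nlinarith [Nat.zero_le (a * b)]
    have hpow : (4 : ℕ) ^ (m + 4) ≤ 2 ^ (k * j) := by
      rw [show (4 : ℕ) = 2 ^ 2 from rfl, ← pow_mul]
      exact Nat.pow_le_pow_right two_pos this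
    calc _ = 2 ^ (k.choose 2 + j.choose 2) * 4 ^ (m + 4) * (m + 6).choose k := by ring
      _ ≤ _ := by gcongr

theorem eight_mul_sum_choose_mul_two_pow_le (m : ℕ) :
    8 * ∑ k ∈ Ico 1 (m + 6), (m + 6).choose k * 2 ^ (k.choose 2 + (m + 6 - k).choose 2) ≤
      5 * 2 ^ (m + 6).choose 2 := by
  have h := sum_le_sum fun k (hk : k ∈ Ico 1 (m + 6)) => choose_mul_two_pow_le hk
  rw [← sum_mul, ← mul_sum, sum_add_distrib, sum_add_distrib, sum_ite_eq', sum_ite_eq',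
    if_pos (by simp), if_pos (by simp)] at h
  have h1 : ∑ k ∈ Ico 1 (m + 6), (m + 6).choose k ≤ 2 ^ (m + 6) := by
    rw [← Nat.sum_range_choose]
    exact sum_le_sum_of_subset fun k hk => by simp at hk ⊢; omega
  have h2 : m + 1 ≤ 2 ^ m := Nat.lt_two_pow_self
  have h4 : (4 : ℕ) ^ (m + 4) = 256 * (2 ^ m * 2 ^ m) := by
    rw [pow_add, ← mul_pow]; norm_num; ring
  -- Equality at m = 0: this fixes the constant 5/8 and the threshold n = 6.
  have h5 : 8 * (2 ^ (m + 6) + ((m + 6) * 2 ^ (m + 3) + (m + 6) * 2 ^ (m + 3))) ≤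
      5 * 4 ^ (m + 4) := by
    rw [h4, pow_add, pow_add]
    nlinarith
  have h6 : (0 : ℕ) < 4 ^ (m + 4) := by positivity
  refine le_of_mul_le_mul_right ?_ h6
  calc _ = 8 * ((∑ k ∈ Ico 1 (m + 6), (m + 6).choose k * 2 ^ (k.choose 2 + (m + 6 - k).choose 2)) *
        4 ^ (m + 4)) := by ring
    _ ≤ 8 * (2 ^ (m + 6).choose 2 *
        (2 ^ (m + 6) + ((m + 6) * 2 ^ (m + 3) + (m + 6) * 2 ^ (m + 3)))) := by
      exact Nat.mul_le_mul_left _ (h.trans (by gcongr))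
    _ = 2 ^ (m + 6).choose 2 *
        (8 * (2 ^ (m + 6) + ((m + 6) * 2 ^ (m + 3) + (m + 6) * 2 ^ (m + 3)))) := by ring
    _ ≤ 2 ^ (m + 6).choose 2 * (5 * 4 ^ (m + 4)) := by gcongr
    _ = _ := by ring

/-- Below the middle the binomials increase, so three consecutive ones starting at r fit into the
row sum. -/
theorem three_mul_choose_le_two_pow {N r : ℕ} (h : 2 * r + 4 ≤ N) : 3 * N.choose r ≤ 2 ^ N := by
  have h1 : N.choose r ≤ N.choose (r + 1) := Nat.choose_le_succ_of_lt_half_left (by omega)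
  have h2 : N.choose (r + 1) ≤ N.choose (r + 2) := Nat.choose_le_succ_of_lt_half_left (by omega)
  have h3 : ∑ k ∈ Ico r (r + 3), N.choose k ≤ 2 ^ N := by
    rw [← Nat.sum_range_choose]
    exact sum_le_sum_of_subset fun k hk => by simp at hk ⊢; omega
  simp [sum_Ico_eq_sum_range, sum_range_succ] at h3
  omega

theorem choose_le_neg_signedComponentSum {n : ℕ} (hn : 4 ≤ n) :
    ((n.choose 2).choose (n - 1) : ℤ) ≤ -signedComponentSum (Fin n) := by
  obtain rfl | rfl | h : n = 4 ∨ n = 5 ∨ 6 ≤ n := by omega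
  · rw [signedComponentSum_fin_four]
    norm_num [Nat.choose]
  · rw [signedComponentSum_fin_five]
    norm_num [Nat.choose]
  · obtain ⟨m, rfl⟩ := Nat.exists_eq_add_of_le' h
    refine le_trans ?_ (two_pow_sub_le_neg_signedComponentSum (by omega))
    have h1 := eight_mul_sum_choose_mul_two_pow_le m
    have h2 : 3 * ((m + 6).choose 2).choose (m + 6 - 1) ≤ 2 ^ (m + 6).choose 2 := by
      refine three_mul_choose_le_two_pow ?_
      have := choose_two_add m 6
      norm_num [Nat.choose] at this ⊢
      omega
    zify at h1 h2
    -- Closes because 1/3 ≤ 1 - 5/8.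
    linarith [pow_pos (two_pos (α := ℤ)) ((m + 6).choose 2)]

end SimpleGraph

/-! ### Evaluations of the Tutte polynomial. -/

open Finset in
theorem Matroid.eval_tuttePolynomial {α : Type*} (M : Matroid α) [M.Finite] (x y : ℤ) :
    MvPolynomial.eval ![x, y] M.tuttePolynomial =
      ∑ A ∈ M.ground_finite.toFinset.powerset,
        (x - 1) ^ ((M.eRk M.E).toNat - (M.eRk (A : Set α)).toNat) *
          (y - 1) ^ (#A - (M.eRk (A : Set α)).toNat) := by
  simp [Matroid.tuttePolynomial]

open Finset in
theorem Matroid.toNat_eRk_le_card {α : Type*} (M : Matroid α) (A : Finset α) :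
    (M.eRk (A : Set α)).toNat ≤ #A := by
  have h := M.eRk_le_encard (A : Set α)
  rw [Set.encard_coe_eq_coe_finsetCard] at h
  exact ENat.toNat_le_of_le_natCast h

namespace SimpleGraph

open Finset

theorem card_cycleMatroid_ground_completeGraph {V : Type*} [Fintype V] :
    #(completeGraph V).cycleMatroid.ground_finite.toFinset = (Fintype.card V).choose 2 := by
  classical
  rw [← card_edgeFinset_top_eq_card_choose_two (V := V)]
  congr 1
  ext e
  simp

theorem toNat_eRk_cycleMatroid_ground_add_one {V : Type*} [Fintype V] {G : SimpleGraph V}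
    (hG : G.Connected) :
    (G.cycleMatroid.eRk G.cycleMatroid.E).toNat + 1 = Fintype.card V := by
  have h := eRk_cycleMatroid (G := G) subset_rfl
  have : Nat.card G.ConnectedComponent = 1 := by
    have := hG.nonempty
    have := hG.preconnected.subsingleton_connectedComponent
    exact Nat.card_unique
  rwa [fromEdgeSet_edgeSet, this, Nat.card_eq_fintype_card] at h

theorem eval_tuttePolynomial_completeGraph_zero_two {V : Type*} [Fintype V] [Nonempty V] :
    MvPolynomial.eval ![0, 2] (completeGraph V).cycleMatroid.tuttePolynomial =
      -signedComponentSum V := by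
  classical
  have hE := toNat_eRk_cycleMatroid_ground_add_one (connected_top (V := V))
  rw [Matroid.eval_tuttePolynomial, signedComponentSum, ← sum_neg_distrib]
  refine sum_nbij' (fun A => fromEdgeSet (A : Set (Sym2 V))) (fun G => G.edgeFinset) ?_ ?_ ?_ ?_ ?_
  · simp
  · intro G _
    rw [mem_powerset]
    intro e he
    simpa using edgeSet_mono (le_top : G ≤ ⊤) (mem_edgeFinset.1 he)
  · intro A hA
    rw [mem_powerset, Set.Finite.subset_toFinset] at hA
    rw [← coe_inj, coe_edgeFinset]
    exact edgeSet_fromEdgeSet_of_subset hA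
  · simp
  · intro A hA
    rw [mem_powerset, Set.Finite.subset_toFinset] at hA
    have hr := eRk_cycleMatroid hA
    have hpos : 0 < Nat.card (fromEdgeSet (A : Set (Sym2 V))).ConnectedComponent :=
      Nat.card_pos
    rw [Nat.card_eq_fintype_card (α := V)] at hr
    obtain ⟨c, hc⟩ := Nat.exists_eq_add_of_lt hpos
    have : ((completeGraph V).cycleMatroid.eRk (completeGraph V).cycleMatroid.E).toNat -
        ((completeGraph V).cycleMatroid.eRk (A : Set (Sym2 V))).toNat = c := by
      rw [show completeGraph V = (⊤ : SimpleGraph V) from rfl] at *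
      omega
    rw [this, hc]
    simp [pow_succ]

/-- Every term is a power of 0, and it vanishes unless |A| = r(A) = r(E) = |V| - 1. -/
theorem eval_tuttePolynomial_cycleMatroid_one_one_le {V : Type*} [Fintype V] {G : SimpleGraph V}
    (hG : G.Connected) :
    MvPolynomial.eval ![1, 1] G.cycleMatroid.tuttePolynomial ≤
      (#G.cycleMatroid.ground_finite.toFinset).choose (Fintype.card V - 1) := by
  classical
  have hE := toNat_eRk_cycleMatroid_ground_add_one hG
  rw [Matroid.eval_tuttePolynomial, ← card_powersetCard, powersetCard_eq_filter, ← sum_boole]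
  refine sum_le_sum fun A _ => ?_
  have h1 := G.cycleMatroid.toNat_eRk_le_card A
  have h2 : (G.cycleMatroid.eRk (A : Set (Sym2 V))).toNat ≤
      (G.cycleMatroid.eRk G.cycleMatroid.E).toNat :=
    ENat.toNat_le_toNat (by rw [Matroid.eRk_ground]; exact G.cycleMatroid.eRk_le_eRank _)
      (Matroid.isRkFinite_set _ _).eRk_lt_top.ne
  rw [sub_self, ← pow_add]
  split_ifs with h
  · exact pow_le_one₀ le_rfl zero_le_one
  · rw [zero_pow (by omega)]

theorem isAcyclic_fromEdgeSet_of_card_le_two {V : Type*} {A : Finset (Sym2 V)} (hA : #A ≤ 2) :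
    (fromEdgeSet (A : Set (Sym2 V))).IsAcyclic := by
  classical
  intro v p hp
  have h := hp.three_le_length
  have hsub : p.edges.toFinset ⊆ A := by
    intro e he
    have := p.edges_subset_edgeSet (List.mem_toFinset.1 he)
    rw [edgeSet_fromEdgeSet] at this
    exact this.1
  have := card_le_card hsub
  rw [List.toFinset_card_of_nodup hp.isTrail.edges_nodup, Walk.length_edges] at this
  omega

theorem six_le_eval_tuttePolynomial_completeGraph_two_zero {V : Type*} [Fintype V]
    (hV : Fintype.card V = 3) :
    6 ≤ MvPolynomial.eval ![2, 0] (completeGraph V).cycleMatroid.tuttePolynomial := by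
  classical
  set M := (completeGraph V).cycleMatroid with hM
  have hcard : #M.ground_finite.toFinset = 3 := by
    rw [hM, card_cycleMatroid_ground_completeGraph, hV]; rfl
  rw [Matroid.eval_tuttePolynomial]
  -- Each proper subset of the triangle is independent and contributes 1; the full set contributes
  -- at least -1 = 1 - 2, so the total is at least 8 - 2.
  have key : ∀ A ∈ M.ground_finite.toFinset.powerset,
      (1 : ℤ) - (if A = M.ground_finite.toFinset then 2 else 0) ≤
        (2 - 1) ^ ((M.eRk M.E).toNat - (M.eRk (A : Set (Sym2 V))).toNat) *
          (0 - 1) ^ (#A - (M.eRk (A : Set (Sym2 V))).toNat) := by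
    intro A hA
    rw [mem_powerset] at hA
    split_ifs with h
    · rcases neg_one_pow_eq_or ℤ (#A - (M.eRk (A : Set (Sym2 V))).toNat) with h | h <;> simp [h]
    · have hlt := card_lt_card (hA.ssubset_of_ne h)
      have hI : M.Indep (A : Set (Sym2 V)) :=
        ⟨Set.Finite.subset_toFinset.1 hA, isAcyclic_fromEdgeSet_of_card_le_two (by omega)⟩
      simp [hI.eRk_eq_encard]
  refine le_trans ?_ (sum_le_sum key)
  rw [sum_sub_distrib, sum_ite_eq', if_pos (by simp)]
  rw [sum_const, card_powerset, hcard]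
  norm_num

end SimpleGraph

theorem mainTheorem6 (n : ℕ) (hn : 3 ≤ n) :
    MvPolynomial.eval ![1, 1] (SimpleGraph.completeGraph (Fin n)).cycleMatroid.tuttePolynomial ≤
      max
        (MvPolynomial.eval ![2, 0] (SimpleGraph.completeGraph (Fin n)).cycleMatroid.tuttePolynomial)
        (MvPolynomial.eval ![0, 2]
          (SimpleGraph.completeGraph (Fin n)).cycleMatroid.tuttePolynomial) := by
  have : Nonempty (Fin n) := ⟨⟨0, by omega⟩⟩
  have h := SimpleGraph.eval_tuttePolynomial_cycleMatroid_one_one_le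
    (SimpleGraph.connected_top (V := Fin n))
  rw [SimpleGraph.card_cycleMatroid_ground_completeGraph, Fintype.card_fin] at h
  obtain rfl | hn := hn.eq_or_lt
  · refine le_max_of_le_left (h.trans (le_trans ?_
      (SimpleGraph.six_le_eval_tuttePolynomial_completeGraph_two_zero (by simp))))
    norm_num [Nat.choose]
  · refine le_max_of_le_right (h.trans ?_)
    rw [SimpleGraph.eval_tuttePolynomial_completeGraph_zero_two]
    exact SimpleGraph.choose_le_neg_signedComponentSum hn
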